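/- Let $N\ge K\ge 1$ and $t\in\{0,1,\dots,K-1\}$ be integers. Consider the $K$-user cache-aided shared-link broadcast channel: a transmitter has a library of $N$ files of $f$ bits each, every user has a cache of size $Mf$ bits that is filled from the library before the requests are known, and afterwards every user requests one file and all users receive, without error, the same signal, at a rate of one file ($f$ bits) per unit of time. A delay $T$ is achievable if for every $\varepsilon>0$ and all sufficiently large $f$ there is a caching and delivery scheme whose delivery phase lasts at most $T+\varepsilon$ units of time for every request, and in which, for independent uniformly distributed files, under every request every user fails to recover its requested file with probability at most $\varepsilon$; it is achievable with zero error if the schemes can be chosen such that no user ever fails. Let $T^*$ be the infimum of all achievable delays. Put $\gamma=M/N$ and assume that $K\gamma\in[t,t+1]$. Then $$T''(K)=\big((t+1)-K\gamma\big)\frac{K-t}{t+1}+(K\gamma-t)\frac{K-(t+1)}{t+2}=\frac{K-t}{t+1}-\frac{(K\gamma-t)(K+1)}{(t+1)(t+2)}$$ is achievable, even with zero error, and $T''(K)\le 4\,T^*$. If moreover $\gamma<1$, then $T^*>0$ and $\frac{T''(K)}{T^*}<4$. -/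

import Mathlib

namespace CodedCaching

/-- A library of `N` files, each consisting of `F` bits. -/
abbrev Library (N F : ℕ) : Type := Fin N → Fin F → Bool

/-- A request: user `k` asks for the file with index `d k`. -/
abbrev Demand (K N : ℕ) : Type := Fin K → Fin N

/-- A caching scheme for the `K`-user broadcast channel in which all users observe, without error,
the same transmitted bit string (all links have the same capacity), with `N` files of `F` bits.
The caches are filled before the request is known, from the library alone. The transmitted signal
depends on the request and on the library. Each user sees the signal and its own cache only (and
knows the request). -/
structure Scheme (K N F : ℕ) where
  /-- number of bits stored in each cache -/
  cacheBits : ℕ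
  /-- number of bits transmitted in the delivery phase (the same for every request) -/
  sentBits : ℕ
  /-- the content of the cache of each user -/
  cache : Fin K → Library N F → (Fin cacheBits → Bool)
  /-- the transmitted signal -/
  send : Demand K N → Library N F → (Fin sentBits → Bool)
  /-- the file that user `k` reconstructs from the signal and its cache -/
  decode : Demand K N → Fin K → (Fin sentBits → Bool) → (Fin cacheBits → Bool) → (Fin F → Bool)

namespace Scheme

variable {K N F : ℕ}

/-- The reconstruction of the requested file by user `k`, for request `d` and library `W`. -/
def output (S : Scheme K N F) (d : Demand K N) (k : Fin K) (W : Library N F) : Fin F → Bool :=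
  S.decode d k (S.send d W) (S.cache k W)

/-- The probability that user `k` does not recover the requested file, under request `d`, when the
files are independent and uniformly distributed bit strings. -/
noncomputable def errorProb (S : Scheme K N F) (d : Demand K N) (k : Fin K) : ℝ :=
  ((Finset.univ.filter fun W : Library N F => S.output d k W ≠ W (d k)).card : ℝ) /
    (Fintype.card (Library N F) : ℝ)

/-- The duration of the delivery phase. The link carries one file (`F` bits) per unit of time. -/
noncomputable def delay (S : Scheme K N F) : ℝ := (S.sentBits : ℝ) / (F : ℝ)

/-- Every cache fits into the size of `M` files. -/
def FitsCache (S : Scheme K N F) (M : ℝ) : Prop := (S.cacheBits : ℝ) ≤ M * (F : ℝ)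

end Scheme

/-- The delay `T` is achievable with `K` users, `N` files and caches of the size of `M` files:
for every `ε > 0` and every large enough file size there is a scheme of delay at most `T + ε`
in which, for every request, every user fails with probability at most `ε`. -/
def Achievable (K N : ℕ) (M T : ℝ) : Prop :=
  ∀ ε : ℝ, 0 < ε → ∀ᶠ F : ℕ in Filter.atTop, ∃ S : Scheme K N F,
    S.FitsCache M ∧ S.delay ≤ T + ε ∧ ∀ d k, S.errorProb d k ≤ ε

/-- The same with schemes that never fail: every user recovers its file, whatever the request and
the content of the library. -/
def ZeroErrorAchievable (K N : ℕ) (M T : ℝ) : Prop :=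
  ∀ ε : ℝ, 0 < ε → ∀ᶠ F : ℕ in Filter.atTop, ∃ S : Scheme K N F,
    S.FitsCache M ∧ S.delay ≤ T + ε ∧ ∀ d k W, S.output d k W = W (d k)

/-- The optimal delay, over all schemes (with vanishing probability of error). -/
noncomputable def optimalDelay (K N : ℕ) (M : ℝ) : ℝ := sInf {T : ℝ | Achievable K N M T}

/-- The delay `T''(K)`: the linear interpolation in `K γ`, between the integers `t` and `t + 1`, of
the delays `(K - t) / (t + 1)` and `(K - (t + 1)) / (t + 2)`. -/
noncomputable def sharedDelay (K t : ℕ) (γ : ℝ) : ℝ :=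
  (((t : ℝ) + 1) - (K : ℝ) * γ) * (((K : ℝ) - (t : ℝ)) / ((t : ℝ) + 1)) +
    ((K : ℝ) * γ - (t : ℝ)) * (((K : ℝ) - ((t : ℝ) + 1)) / ((t : ℝ) + 2))

end CodedCaching

/-!
*Achievability.* At integer values of `K γ` all users are served by coded multicasting: every bit of
the signal is the sum of bits that `t + 1` users want, each of which knows all of them but its own.
Between the integers the files are split and the two neighbouring schemes share the caches.

*Converse.* From one signal, `s` users can decode one after the other if each of them is also given
the caches and files of its predecessors. At every step some file is still almost unknown, namely
one of largest entropy given the caches and files seen so far; letting user `i` request this file,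
one finds `T ≥ ∑ i < s, (1 - (i + 1) M / (N - i))`, up to Fano corrections that vanish in the limit.

*Comparison.* If `K < 4 (t + 1)` then `s = 1` suffices; otherwise `s = ⌊K / (2 (t + 1))⌋` does.
-/

namespace CodedCaching

open Finset

theorem sum_logb_nonpos {ι : Type*} {A : Finset ι} {f : ι → ℝ} {b : ℝ} (hb : 1 < b)
    (hf : ∀ i ∈ A, 0 < f i) (hsum : ∑ i ∈ A, f i ≤ #A) : ∑ i ∈ A, Real.logb b (f i) ≤ 0 :=
  calc ∑ i ∈ A, Real.logb b (f i)
      ≤ ∑ i ∈ A, (f i - 1) / Real.log b := sum_le_sum fun i hi =>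
        div_le_div_of_nonneg_right (Real.log_le_sub_one_of_pos (hf i hi)) (Real.log_pos hb).le
    _ = (∑ i ∈ A, f i - #A) / Real.log b := by simp [← sum_div]
    _ ≤ 0 := div_nonpos_of_nonpos_of_nonneg (sub_nonpos.mpr hsum) (Real.log_pos hb).le

section Entropy

variable {Ω : Type*} [Fintype Ω]

open Classical in
/-- The equivalence class of `ω`, as a finite set. -/
noncomputable def classOf (r : Setoid Ω) (ω : Ω) : Finset Ω := {x | r ω x}

theorem mem_classOf {r : Setoid Ω} {x y : Ω} : y ∈ classOf r x ↔ r x y := by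
  simp [classOf]

theorem classOf_congr {r : Setoid Ω} {x y : Ω} (h : r x y) : classOf r x = classOf r y := by
  ext z
  simp only [mem_classOf]
  exact ⟨r.trans (r.symm h), r.trans h⟩

theorem classOf_mono {r s : Setoid Ω} (h : r ≤ s) (ω : Ω) : classOf r ω ⊆ classOf s ω :=
  fun _ hx => mem_classOf.mpr (h (mem_classOf.mp hx))

theorem card_classOf_pos (r : Setoid Ω) (ω : Ω) : (0 : ℝ) < #(classOf r ω) := by
  exact_mod_cast card_pos.mpr ⟨ω, mem_classOf.mpr (r.refl ω)⟩

theorem sum_inv_card_classOf_le_one (r : Setoid Ω) {A : Finset Ω}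
    (hA : ∀ x ∈ A, ∀ y ∈ A, r x y) : ∑ ω ∈ A, (#(classOf r ω) : ℝ)⁻¹ ≤ 1 := by
  obtain rfl | ⟨a, ha⟩ := A.eq_empty_or_nonempty
  · simp
  have hconst : ∀ ω ∈ A, (#(classOf r ω) : ℝ)⁻¹ = (#(classOf r a) : ℝ)⁻¹ := fun ω hω => by
    rw [classOf_congr (hA ω hω a ha)]
  rw [sum_congr rfl hconst, sum_const, nsmul_eq_mul, mul_inv_le_iff₀ (card_classOf_pos r a),
    one_mul]
  exact_mod_cast card_le_card fun x hx => mem_classOf.mpr (hA a ha x hx)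

/-- The Shannon entropy, in bits, of the equivalence class of a uniformly distributed point.
A random variable `X` is represented by the partition `Setoid.ker X` into its level sets, so that
`r ⊓ s` stands for the pair of two variables and `r ≤ s` says that the first determines the
second. -/
noncomputable def entropy (r : Setoid Ω) : ℝ :=
  (∑ ω, Real.logb 2 (Fintype.card Ω / #(classOf r ω))) / Fintype.card Ω

/-- The entropy of `r` conditioned on `t`, in bits. -/
noncomputable def condEntropy (r t : Setoid Ω) : ℝ := entropy (r ⊓ t) - entropy t

theorem entropy_antitone : Antitone (entropy : Setoid Ω → ℝ) := by
  intro r s h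
  refine div_le_div_of_nonneg_right (sum_le_sum fun ω _ => ?_) (Nat.cast_nonneg _)
  have hΩ : (0 : ℝ) < Fintype.card Ω := by exact_mod_cast Fintype.card_pos_iff.mpr ⟨ω⟩
  refine Real.logb_le_logb_of_le one_lt_two (div_pos hΩ (card_classOf_pos s ω)) ?_
  exact div_le_div_of_nonneg_left hΩ.le (card_classOf_pos r ω)
    (by exact_mod_cast card_le_card (classOf_mono h ω))

theorem entropy_bot : entropy (⊥ : Setoid Ω) = Real.logb 2 (Fintype.card Ω) := by
  have hclass (ω : Ω) : classOf ⊥ ω = {ω} := by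
    ext x
    simp [mem_classOf, eq_comm]
  obtain h | h := isEmpty_or_nonempty Ω <;> simp [entropy, hclass]

theorem entropy_top : entropy (⊤ : Setoid Ω) = 0 := by
  have hclass (ω : Ω) : classOf ⊤ ω = univ := by
    ext x
    simp [mem_classOf, Setoid.top_def]
  simp only [entropy, hclass, card_univ]
  obtain h | h := isEmpty_or_nonempty Ω <;> simp

theorem entropy_ker_le_gibbs {α : Type*} [Fintype α] (X : Ω → α) {q : α → ℝ}
    (hq : ∀ a, 0 < q a) (hsum : ∑ a, q a ≤ 1) :
    entropy (Setoid.ker X) ≤ (∑ ω, -Real.logb 2 (q (X ω))) / Fintype.card Ω := by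
  classical
  set c : Ω → ℝ := fun ω => #(classOf (Setoid.ker X) ω)
  have hc : ∀ ω, 0 < c ω := card_classOf_pos _
  have hfiber : ∑ ω, q (X ω) * (c ω)⁻¹ ≤ 1 :=
    calc ∑ ω, q (X ω) * (c ω)⁻¹
        = ∑ a, ∑ ω with X ω = a, q (X ω) * (c ω)⁻¹ := (sum_fiberwise _ _ _).symm
      _ = ∑ a, q a * ∑ ω with X ω = a, (c ω)⁻¹ := by
          refine sum_congr rfl fun a _ => ?_
          rw [mul_sum]
          exact sum_congr rfl fun ω hω => by rw [(mem_filter.mp hω).2]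
      _ ≤ ∑ a, q a := by
          refine sum_le_sum fun a _ => mul_le_of_le_one_right (hq a).le ?_
          refine sum_inv_card_classOf_le_one _ fun x hx y hy => ?_
          exact (mem_filter.mp hx).2.trans (mem_filter.mp hy).2.symm
      _ ≤ 1 := hsum
  refine div_le_div_of_nonneg_right ?_ (Nat.cast_nonneg _)
  change ∑ ω, Real.logb 2 (Fintype.card Ω / c ω) ≤ _
  rw [← sub_nonpos, ← sum_sub_distrib]
  have hΩ (ω : Ω) : (0 : ℝ) < Fintype.card Ω := by exact_mod_cast Fintype.card_pos_iff.mpr ⟨ω⟩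
  have hlog (ω : Ω) : Real.logb 2 (Fintype.card Ω / c ω) - -Real.logb 2 (q (X ω)) =
      Real.logb 2 (Fintype.card Ω * (q (X ω) * (c ω)⁻¹)) := by
    rw [sub_neg_eq_add, ← Real.logb_mul (div_pos (hΩ ω) (hc ω)).ne' (hq _).ne']
    ring_nf
  simp only [hlog]
  refine sum_logb_nonpos one_lt_two
    (fun ω _ => mul_pos (hΩ ω) (mul_pos (hq _) (inv_pos.mpr (hc ω)))) ?_
  rw [← mul_sum, card_univ]
  exact mul_le_of_le_one_right (Nat.cast_nonneg _) hfiber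

theorem entropy_ker_le_logb_card {α : Type*} [Fintype α] (X : Ω → α) :
    entropy (Setoid.ker X) ≤ Real.logb 2 (Fintype.card α) := by
  obtain hΩ | ⟨⟨ω⟩⟩ := isEmpty_or_nonempty Ω
  · simpa [entropy, Real.logb] using
      div_nonneg (Real.log_natCast_nonneg _) (Real.log_nonneg one_le_two)
  have : Nonempty α := ⟨X ω⟩
  have : Nonempty Ω := ⟨ω⟩
  have hα : (0 : ℝ) < Fintype.card α := by exact_mod_cast Fintype.card_pos
  refine (entropy_ker_le_gibbs X (fun _ => inv_pos.mpr hα) ?_).trans_eq ?_ <;> simp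

theorem sum_card_classOf_mul_div_le {r s t : Setoid Ω} (hr : r ≤ t) (hs : s ≤ t) :
    ∑ ω, (#(classOf r ω) * #(classOf s ω) / (#(classOf (r ⊓ s) ω) * #(classOf t ω)) : ℝ) ≤
      Fintype.card Ω := by
  classical
  calc ∑ ω, (#(classOf r ω) * #(classOf s ω) / (#(classOf (r ⊓ s) ω) * #(classOf t ω)) : ℝ)
      = ∑ ω, ∑ p ∈ classOf r ω ×ˢ classOf s ω,
          (#(classOf (r ⊓ s) ω) : ℝ)⁻¹ * (#(classOf t p.1) : ℝ)⁻¹ := by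
        refine sum_congr rfl fun ω _ => ?_
        have hclass : ∀ p ∈ classOf r ω ×ˢ classOf s ω, classOf t p.1 = classOf t ω :=
          fun p hp => (classOf_congr (hr (mem_classOf.mp (mem_product.mp hp).1))).symm
        rw [sum_congr rfl fun p hp => by rw [hclass p hp], sum_const, card_product, nsmul_eq_mul]
        push_cast
        field_simp
    _ = ∑ p : Ω × Ω with t p.1 p.2, ∑ ω ∈ classOf r p.1 ∩ classOf s p.2,
          (#(classOf (r ⊓ s) ω) : ℝ)⁻¹ * (#(classOf t p.1) : ℝ)⁻¹ := by
        refine sum_comm' fun ω p => ?_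
        simp only [mem_univ, true_and, mem_product, mem_inter, mem_filter, mem_classOf]
        constructor
        · rintro ⟨h₁, h₂⟩
          exact ⟨⟨r.symm h₁, s.symm h₂⟩, t.trans (t.symm (hr h₁)) (hs h₂)⟩
        · rintro ⟨⟨h₁, h₂⟩, -⟩
          exact ⟨r.symm h₁, s.symm h₂⟩
    _ ≤ ∑ p : Ω × Ω with t p.1 p.2, (#(classOf t p.1) : ℝ)⁻¹ := by
        refine sum_le_sum fun p _ => ?_
        rw [← sum_mul]
        refine mul_le_of_le_one_left (inv_nonneg.mpr (Nat.cast_nonneg _)) ?_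
        refine sum_inv_card_classOf_le_one _ fun x hx y hy => ?_
        simp only [mem_inter, mem_classOf] at hx hy
        exact ⟨r.trans (r.symm hx.1) hy.1, s.trans (s.symm hx.2) hy.2⟩
    _ = ∑ a, ∑ _ ∈ classOf t a, (#(classOf t a) : ℝ)⁻¹ :=
        sum_finset_product _ _ _ fun p => by simp [mem_classOf]
    _ = Fintype.card Ω := by
        simp [mul_inv_cancel₀ (card_classOf_pos t _).ne']

theorem entropy_submodular {r s t : Setoid Ω} (hr : r ≤ t) (hs : s ≤ t) :
    entropy (r ⊓ s) + entropy t ≤ entropy r + entropy s := by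
  unfold entropy
  rw [← add_div, ← add_div, ← sum_add_distrib, ← sum_add_distrib]
  refine div_le_div_of_nonneg_right ?_ (Nat.cast_nonneg _)
  rw [← sub_nonpos, ← sum_sub_distrib]
  have hlog (ω : Ω) : Real.logb 2 (Fintype.card Ω / #(classOf (r ⊓ s) ω)) +
        Real.logb 2 (Fintype.card Ω / #(classOf t ω)) -
        (Real.logb 2 (Fintype.card Ω / #(classOf r ω)) +
          Real.logb 2 (Fintype.card Ω / #(classOf s ω))) =
      Real.logb 2
        (#(classOf r ω) * #(classOf s ω) / (#(classOf (r ⊓ s) ω) * #(classOf t ω))) := by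
    have hΩ : (Fintype.card Ω : ℝ) ≠ 0 := by
      exact_mod_cast (Fintype.card_pos_iff.mpr ⟨ω⟩).ne'
    have hc (u : Setoid Ω) : (#(classOf u ω) : ℝ) ≠ 0 := (card_classOf_pos u ω).ne'
    rw [Real.logb_div (mul_ne_zero (hc r) (hc s)) (mul_ne_zero (hc _) (hc t)),
      Real.logb_mul (hc r) (hc s), Real.logb_mul (hc _) (hc t)]
    simp only [Real.logb_div hΩ (hc _)]
    ring
  simp only [hlog]
  refine sum_logb_nonpos one_lt_two (fun ω _ => ?_) (sum_card_classOf_mul_div_le hr hs)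
  have hc (u : Setoid Ω) : (0 : ℝ) < #(classOf u ω) := card_classOf_pos u ω
  exact div_pos (mul_pos (hc r) (hc s)) (mul_pos (hc _) (hc t))

theorem condEntropy_nonneg (r t : Setoid Ω) : 0 ≤ condEntropy r t :=
  sub_nonneg.mpr (entropy_antitone inf_le_right)

theorem condEntropy_top (r : Setoid Ω) : condEntropy r ⊤ = entropy r := by
  simp [condEntropy, entropy_top]

theorem entropy_nonneg (r : Setoid Ω) : 0 ≤ entropy r :=
  condEntropy_top r ▸ condEntropy_nonneg r ⊤

theorem condEntropy_inf (r s t : Setoid Ω) :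
    condEntropy (r ⊓ s) t = condEntropy r (s ⊓ t) + condEntropy s t := by
  simp only [condEntropy, inf_assoc]
  ring

theorem condEntropy_le_of_le_left {r s : Setoid Ω} (h : r ≤ s) (t : Setoid Ω) :
    condEntropy s t ≤ condEntropy r t :=
  sub_le_sub_right (entropy_antitone (inf_le_inf_right t h)) _

theorem condEntropy_le_of_le_right (r : Setoid Ω) {s t : Setoid Ω} (h : s ≤ t) :
    condEntropy r s ≤ condEntropy r t := by
  have hsub := entropy_submodular (inf_le_right : r ⊓ t ≤ t) h
  rw [inf_assoc, inf_eq_right.mpr h] at hsub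
  unfold condEntropy
  linarith

theorem condEntropy_le_entropy (r t : Setoid Ω) : condEntropy r t ≤ entropy r :=
  (condEntropy_le_of_le_right r le_top).trans_eq (condEntropy_top r)

theorem condEntropy_finset_inf_le {ι : Type*} (A : Finset ι) (w : ι → Setoid Ω) (t : Setoid Ω) :
    condEntropy (A.inf w) t ≤ ∑ j ∈ A, condEntropy (w j) t := by
  classical
  induction A using Finset.induction_on with
  | empty => simp [condEntropy]
  | insert a A ha ih =>
    rw [inf_insert, sum_insert ha, condEntropy_inf]
    exact add_le_add (condEntropy_le_of_le_right _ inf_le_right) ih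

theorem entropy_finset_inf_le {ι : Type*} (A : Finset ι) (w : ι → Setoid Ω) :
    entropy (A.inf w) ≤ ∑ j ∈ A, entropy (w j) := by
  simpa only [condEntropy_top] using condEntropy_finset_inf_le A w ⊤

theorem condEntropy_ker_le_fano {α : Type*} [Fintype α] [DecidableEq α] (X Y : Ω → α) :
    condEntropy (Setoid.ker X) (Setoid.ker Y) ≤
      1 + #{ω | Y ω ≠ X ω} / Fintype.card Ω * Real.logb 2 (Fintype.card α) := by
  obtain hΩ | ⟨⟨ω₀⟩⟩ := isEmpty_or_nonempty Ω
  · simp [condEntropy, entropy]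
  have hΩ : (0 : ℝ) < Fintype.card Ω := by exact_mod_cast Fintype.card_pos_iff.mpr ⟨ω₀⟩
  have hα : (0 : ℝ) < Fintype.card α := by exact_mod_cast Fintype.card_pos_iff.mpr ⟨X ω₀⟩
  -- What has to be appended to `Y` so that `X` can be recovered.
  let correction : Ω → Option α := fun ω => if Y ω = X ω then none else some (X ω)
  have hdet : Setoid.ker correction ⊓ Setoid.ker Y ≤ Setoid.ker X := by
    rintro ω ω' ⟨hC, hY⟩
    simp only [correction, Setoid.ker_def] at hC hY ⊢
    grind
  let q : Option α → ℝ := fun o => o.elim 2⁻¹ fun _ => 2⁻¹ * (Fintype.card α : ℝ)⁻¹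
  have hq : ∀ o, 0 < q o := by
    rintro (_ | a)
    · simp [q]
    · simpa [q] using hα
  have hsum : ∑ o, q o ≤ 1 := by
    rw [Fintype.sum_option]
    simp only [q, Option.elim_none, Option.elim_some, sum_const, card_univ, nsmul_eq_mul]
    field_simp
    norm_num
  have hlog (ω : Ω) : -Real.logb 2 (q (correction ω)) =
      1 + if Y ω ≠ X ω then Real.logb 2 (Fintype.card α) else 0 := by
    by_cases h : Y ω = X ω
    · simp [q, correction, h, Real.logb_inv]
    · simp only [q, correction, h, if_false, Option.elim_some, ne_eq, not_false_eq_true, if_true]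
      rw [← mul_inv, Real.logb_inv, Real.logb_mul two_ne_zero hα.ne',
        Real.logb_self_eq_one one_lt_two, neg_neg]
  calc condEntropy (Setoid.ker X) (Setoid.ker Y)
      ≤ condEntropy (Setoid.ker correction ⊓ Setoid.ker Y) (Setoid.ker Y) :=
        condEntropy_le_of_le_left hdet _
    _ = condEntropy (Setoid.ker correction) (Setoid.ker Y) := by
        simp only [condEntropy, inf_assoc, inf_idem]
    _ ≤ entropy (Setoid.ker correction) := condEntropy_le_entropy _ _
    _ ≤ (∑ ω, -Real.logb 2 (q (correction ω))) / Fintype.card Ω :=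
        entropy_ker_le_gibbs correction hq hsum
    _ = 1 + #{ω | Y ω ≠ X ω} / Fintype.card Ω * Real.logb 2 (Fintype.card α) := by
        simp only [hlog, sum_add_distrib, ← sum_filter, sum_const, card_univ, nsmul_eq_mul]
        field_simp

theorem condEntropy_add_condEntropy_le (y z v P : Setoid Ω) :
    condEntropy v (z ⊓ P) + condEntropy y (v ⊓ (z ⊓ P)) ≤
      condEntropy y P + condEntropy v (y ⊓ z) := by
  have hside : condEntropy y (z ⊓ P) ≤ condEntropy y P :=
    condEntropy_le_of_le_right y inf_le_right
  have hdec : condEntropy v (y ⊓ (z ⊓ P)) ≤ condEntropy v (y ⊓ z) :=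
    condEntropy_le_of_le_right v (inf_le_inf_left y inf_le_left)
  have hyv := condEntropy_inf y v (z ⊓ P)
  have hvy := condEntropy_inf v y (z ⊓ P)
  rw [inf_comm] at hvy
  linarith

/-- Successive decoding: a signal `y` from which, with side information `z i`, the variable `v i`
can almost be recovered carries everything that is new in `v i` at its turn. -/
theorem sum_condEntropy_le_entropy (y : Setoid Ω) (z v : ℕ → Setoid Ω) {δ : ℝ} {s : ℕ}
    (hdec : ∀ i < s, condEntropy (v i) (y ⊓ z i) ≤ δ) :
    ∑ i ∈ range s, condEntropy (v i) ((range (i + 1)).inf z ⊓ (range i).inf v) ≤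
      entropy y + s * δ := by
  suffices h : ∑ i ∈ range s, condEntropy (v i) ((range (i + 1)).inf z ⊓ (range i).inf v) +
      condEntropy y ((range s).inf z ⊓ (range s).inf v) ≤ entropy y + s * δ from
    (le_add_of_nonneg_right (condEntropy_nonneg _ _)).trans h
  induction s with
  | zero => simp [condEntropy_top]
  | succ s ih =>
    have hstep := condEntropy_add_condEntropy_le y (z s) (v s) ((range s).inf z ⊓ (range s).inf v)
    have hz : z s ⊓ ((range s).inf z ⊓ (range s).inf v) =
        (range (s + 1)).inf z ⊓ (range s).inf v := by
      rw [range_add_one, inf_insert, inf_assoc]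
    have hv : v s ⊓ ((range (s + 1)).inf z ⊓ (range s).inf v) =
        (range (s + 1)).inf z ⊓ (range (s + 1)).inf v := by
      rw [range_add_one (n := s), inf_insert (f := v), inf_left_comm]
    rw [hz, hv] at hstep
    have hrec := ih fun i hi => hdec i (hi.trans s.lt_succ_self)
    have hs := hdec s s.lt_succ_self
    rw [sum_range_succ]
    push_cast
    linarith

theorem sub_le_sum_compl_condEntropy {ι : Type*} [Fintype ι] [DecidableEq ι]
    {w : ι → Setoid Ω} {h : ℝ} (hw : ∀ j, entropy (w j) ≤ h)
    (hjoint : Fintype.card ι * h ≤ entropy (univ.inf w)) (t : Setoid Ω) (B : Finset ι) :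
    #Bᶜ * h - entropy t ≤ ∑ j ∈ Bᶜ, condEntropy (w j) (t ⊓ B.inf w) := by
  have hB : entropy (B.inf w) ≤ #B * h := by
    rw [← nsmul_eq_mul]
    exact (entropy_finset_inf_le B w).trans (sum_le_card_nsmul _ _ _ fun j _ => hw j)
  have hBc := condEntropy_finset_inf_le Bᶜ w (t ⊓ B.inf w)
  have hdet : Bᶜ.inf w ⊓ (t ⊓ B.inf w) ≤ univ.inf w := by
    rw [← union_compl B, union_comm, inf_union]
    exact inf_le_inf_left _ inf_le_right
  have hcard : (#Bᶜ : ℝ) + #B = Fintype.card ι := by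
    exact_mod_cast card_compl_add_card B
  have hanti := entropy_antitone hdet
  have ht := condEntropy_le_entropy t (B.inf w)
  unfold condEntropy at hBc ht ⊢
  rw [← hcard] at hjoint
  linarith

theorem exists_le_condEntropy {ι : Type*} [Fintype ι] {w : ι → Setoid Ω} {h : ℝ}
    (hw : ∀ j, entropy (w j) ≤ h) (hjoint : Fintype.card ι * h ≤ entropy (univ.inf w))
    {t : Setoid Ω} {c : ℝ} (ht : entropy t ≤ c) {B : Finset ι} {b : ℕ} (hB : #B ≤ b)
    (hb : b < Fintype.card ι) :
    ∃ j, h - c / (Fintype.card ι - b) ≤ condEntropy (w j) (t ⊓ B.inf w) := by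
  classical
  have hbR : (0 : ℝ) < Fintype.card ι - b := sub_pos.mpr (by exact_mod_cast hb)
  have hcard : (Fintype.card ι - b : ℝ) ≤ #Bᶜ := by
    rw [card_compl, Nat.cast_sub (card_le_univ B)]
    gcongr
  have hne : Bᶜ.Nonempty := card_pos.mp (by exact_mod_cast hbR.trans_le hcard)
  have hcdiv : c ≤ #Bᶜ * (c / (Fintype.card ι - b)) := by
    rw [← mul_div_assoc, le_div_iff₀ hbR, mul_comm]
    exact mul_le_mul_of_nonneg_right hcard ((entropy_nonneg t).trans ht)
  obtain ⟨j, -, hj⟩ := exists_le_of_sum_le hne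
    (f := fun _ => h - c / (Fintype.card ι - b)) (g := fun j => condEntropy (w j) (t ⊓ B.inf w)) <|
    calc ∑ _ ∈ Bᶜ, (h - c / (Fintype.card ι - b))
        = #Bᶜ * h - #Bᶜ * (c / (Fintype.card ι - b)) := by
          rw [sum_const, nsmul_eq_mul, mul_sub]
      _ ≤ #Bᶜ * h - entropy t := by linarith
      _ ≤ _ := sub_le_sum_compl_condEntropy hw hjoint t B
  exact ⟨j, hj⟩

theorem exists_seq_le_condEntropy {ι : Type*} [Fintype ι] [Nonempty ι] {w : ι → Setoid Ω}
    {h : ℝ} (hw : ∀ j, entropy (w j) ≤ h) (hjoint : Fintype.card ι * h ≤ entropy (univ.inf w))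
    (z : ℕ → Setoid Ω) {c : ℝ} (hz : ∀ i, entropy (z i) ≤ c) {s : ℕ}
    (hs : s ≤ Fintype.card ι) :
    ∃ d : ℕ → ι, ∀ i < s, h - (i + 1) * c / (Fintype.card ι - i) ≤
      condEntropy (w (d i)) ((range (i + 1)).inf z ⊓ (range i).inf (w ∘ d)) := by
  classical
  induction s with
  | zero => exact ⟨fun _ => Classical.arbitrary ι, by simp⟩
  | succ s ih =>
    obtain ⟨d, hd⟩ := ih (by omega)
    have hside : entropy ((range (s + 1)).inf z) ≤ (s + 1) * c := by
      refine (entropy_finset_inf_le _ z).trans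
        ((sum_le_card_nsmul _ _ c fun i _ => hz i).trans_eq ?_)
      simp
    obtain ⟨j, hj⟩ := exists_le_condEntropy hw hjoint hside
      (B := (range s).image d) (card_image_le.trans (card_range s).le) (by omega)
    rw [inf_image] at hj
    have hpast (i : ℕ) (hi : i ≤ s) :
        (range i).inf (w ∘ Function.update d s j) = (range i).inf (w ∘ d) :=
      inf_congr rfl fun l hl => by
        rw [Function.comp_apply, Function.update_of_ne ((mem_range.mp hl).trans_le hi).ne,
          Function.comp_apply]
    refine ⟨Function.update d s j, fun i hi => ?_⟩
    rw [hpast i (by omega)]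
    obtain hi | rfl := Nat.lt_succ_iff_lt_or_eq.mp hi
    · rw [Function.update_of_ne hi.ne]
      exact hd i hi
    · rwa [Function.update_self]

end Entropy

section Converse

variable {K N F s : ℕ}

theorem entropy_ker_bits_le {Ω : Type*} [Fintype Ω] {n : ℕ} (X : Ω → Fin n → Bool) :
    entropy (Setoid.ker X) ≤ n := by
  simpa [Real.logb_pow] using entropy_ker_le_logb_card X

theorem entropy_inf_files :
    entropy (univ.inf fun n => Setoid.ker fun W : Library N F => W n) = N * F := by
  have hbot : (univ.inf fun n => Setoid.ker fun W : Library N F => W n) = ⊥ := by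
    rw [eq_bot_iff]
    intro W V h
    exact funext fun n => inf_le (f := fun n => Setoid.ker fun W : Library N F => W n)
      (mem_univ n) h
  simp [hbot, entropy_bot, Real.logb_pow]

theorem Scheme.condEntropy_file_le (S : Scheme K N F) (d : Demand K N) (k : Fin K) :
    condEntropy (Setoid.ker fun W : Library N F => W (d k))
      (Setoid.ker (S.send d) ⊓ Setoid.ker (S.cache k)) ≤ 1 + S.errorProb d k * F := by
  have houtput : Setoid.ker (S.send d) ⊓ Setoid.ker (S.cache k) ≤ Setoid.ker (S.output d k) := by
    rintro W V ⟨hsend, hcache⟩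
    exact congrArg₂ (S.decode d k) hsend hcache
  refine (condEntropy_le_of_le_right _ houtput).trans ((condEntropy_ker_le_fano _ _).trans_eq ?_)
  simp [errorProb, Real.logb_pow]

/-- The first `s` users decode in turn from one signal. User `i` requests a file of which the caches
of the users up to `i` and the files requested before reveal as little as possible. -/
theorem Scheme.converse (S : Scheme K N F) {ε : ℝ} (herr : ∀ d k, S.errorProb d k ≤ ε)
    (hsK : s ≤ K) (hsN : s ≤ N) :
    ∑ i ∈ range s, ((F : ℝ) - (i + 1) * S.cacheBits / (N - i)) ≤
      S.sentBits + s * (1 + ε * F) := by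
  obtain rfl | hs := s.eq_zero_or_pos
  · simp
  have : NeZero K := ⟨(hs.trans_le hsK).ne'⟩
  have : NeZero N := ⟨(hs.trans_le hsN).ne'⟩
  obtain ⟨user, huser⟩ : ∃ user : ℕ → Fin K, ∀ i < s, (user i : ℕ) = i :=
    ⟨Fin.ofNat K, fun i hi => Nat.mod_eq_of_lt (hi.trans_le hsK)⟩
  let file (n : Fin N) : Setoid (Library N F) := Setoid.ker fun W => W n
  let side (i : ℕ) : Setoid (Library N F) := Setoid.ker (S.cache (user i))
  have hfile (n : Fin N) : entropy (file n) ≤ F :=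
    entropy_ker_bits_le fun W : Library N F => W n
  have hjoint : Fintype.card (Fin N) * (F : ℝ) ≤ entropy (univ.inf file) := by
    rw [Fintype.card_fin]
    exact entropy_inf_files.ge
  obtain ⟨d, hd⟩ := exists_seq_le_condEntropy hfile hjoint side
    (fun i => entropy_ker_bits_le (S.cache (user i)))
    (hsN.trans_eq (Fintype.card_fin N).symm)
  rw [Fintype.card_fin] at hd
  let D : Demand K N := fun k => d k
  have hdec : ∀ i < s, condEntropy (file (d i)) (Setoid.ker (S.send D) ⊓ side i) ≤ 1 + ε * F := by
    intro i hi
    have hrec := S.condEntropy_file_le D (user i)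
    simp only [D, huser i hi] at hrec
    exact hrec.trans (by gcongr; exact herr _ _)
  calc ∑ i ∈ range s, ((F : ℝ) - (i + 1) * S.cacheBits / (N - i))
      ≤ ∑ i ∈ range s,
          condEntropy (file (d i)) ((range (i + 1)).inf side ⊓ (range i).inf (file ∘ d)) :=
        sum_le_sum fun i hi => hd i (mem_range.mp hi)
    _ ≤ entropy (Setoid.ker (S.send D)) + s * (1 + ε * F) :=
        sum_condEntropy_le_entropy _ side (file ∘ d) hdec
    _ ≤ S.sentBits + s * (1 + ε * F) := by
        gcongr
        exact entropy_ker_bits_le _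

theorem Achievable.lower_bound {M T : ℝ} (h : Achievable K N M T) (hsK : s ≤ K) (hsN : s ≤ N) :
    ∑ i ∈ range s, (1 - (i + 1) * M / (N - i)) ≤ T := by
  refine le_of_forall_pos_le_add fun η hη => ?_
  obtain ⟨ε, hε, hεη⟩ : ∃ ε : ℝ, 0 < ε ∧ ε + s * (2 * ε) = η :=
    ⟨η / (1 + 2 * s), by positivity, by field_simp⟩
  obtain ⟨F, ⟨S, hcache, hdelay, herr⟩, hF, hεF⟩ := ((h ε hε).and
    ((Filter.eventually_gt_atTop 0).and
      (tendsto_natCast_atTop_atTop.eventually_ge_atTop ε⁻¹))).exists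
  replace hF : (0 : ℝ) < F := by exact_mod_cast hF
  rw [inv_le_iff_one_le_mul₀ hε] at hεF
  rw [Scheme.delay, div_le_iff₀ hF] at hdelay
  refine le_of_mul_le_mul_right ?_ hF
  calc (∑ i ∈ range s, (1 - (i + 1) * M / (N - i))) * F
      ≤ ∑ i ∈ range s, ((F : ℝ) - (i + 1) * S.cacheBits / (N - i)) := by
        rw [sum_mul]
        refine sum_le_sum fun i hi => ?_
        have hiN : (i : ℝ) < N := by exact_mod_cast (mem_range.mp hi).trans_le hsN
        have hfit : (i + 1) * S.cacheBits / (N - i) ≤ (i + 1) * (M * F) / (N - i : ℝ) :=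
          div_le_div_of_nonneg_right (mul_le_mul_of_nonneg_left hcache (by positivity))
            (by linarith)
        linarith [show (1 - (i + 1) * M / (N - i : ℝ)) * F = F - (i + 1) * (M * F) / (N - i) by
          ring]
    _ ≤ S.sentBits + s * (1 + ε * F) := S.converse herr hsK hsN
    _ ≤ (T + ε) * F + s * (2 * ε * F) := by
        gcongr
        linarith
    _ = (T + η) * F := by
        rw [← hεη]
        ring

theorem Achievable.nonneg {M T : ℝ} (h : Achievable K N M T) : 0 ≤ T := by
  simpa using h.lower_bound K.zero_le N.zero_le

end Converse

section Schemes

variable {K N F F₁ F₂ c c₁ c₂ s s₁ s₂ t : ℕ}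

/-- There is a scheme without errors for files of `F` bits, with caches of exactly `c` bits and
signals of exactly `s` bits. -/
def HasExactScheme (K N F c s : ℕ) : Prop :=
  ∃ S : Scheme K N F, S.cacheBits = c ∧ S.sentBits = s ∧ ∀ d k W, S.output d k W = W (d k)

theorem HasExactScheme.of_factorsThrough {β σ : Type*} {κ : Fin K → Type*}
    [Fintype β] [Fintype σ] [∀ k, Fintype (κ k)] (hβ : Fintype.card β = F)
    (hκ : ∀ k, Fintype.card (κ k) = c) (hσ : Fintype.card σ = s)
    (cache : ∀ k, (Fin N → β → Bool) → κ k → Bool)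
    (send : Demand K N → (Fin N → β → Bool) → σ → Bool)
    (hdec : ∀ d k, (fun W : Fin N → β → Bool => W (d k)).FactorsThrough
      fun W => (send d W, cache k W)) :
    HasExactScheme K N F c s := by
  let eβ : β ≃ Fin F := Fintype.equivFinOfCardEq hβ
  let eσ : σ ≃ Fin s := Fintype.equivFinOfCardEq hσ
  let eκ (k : Fin K) : κ k ≃ Fin c := Fintype.equivFinOfCardEq (hκ k)
  let lib (W : Library N F) : Fin N → β → Bool := fun n => W n ∘ eβ
  let decode (d : Demand K N) (k : Fin K) : (σ → Bool) × (κ k → Bool) → β → Bool :=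
    Function.extend (fun W => (send d W, cache k W)) (fun W => W (d k)) fun _ _ => false
  refine ⟨⟨c, s, fun k W => cache k (lib W) ∘ (eκ k).symm, fun d W => send d (lib W) ∘ eσ.symm,
    fun d k x y => decode d k (x ∘ eσ, y ∘ eκ k) ∘ eβ.symm⟩, rfl, rfl, fun d k W => ?_⟩
  have hlib : decode d k (send d (lib W), cache k (lib W)) = lib W (d k) :=
    (hdec d k).extend_apply _ _
  funext i
  simp [Scheme.output, Function.comp_assoc, hlib, lib]

theorem hasExactScheme_uncoded (K N F : ℕ) : HasExactScheme K N F 0 (K * F) :=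
  .of_factorsThrough (β := Fin F) (σ := Fin K × Fin F) (κ := fun _ => Empty)
    (by simp) (by simp) (by simp) (fun _ _ => Empty.elim) (fun d W p => W (d p.1) p.2)
    fun _ k _ _ h => funext fun i => congrFun (congrArg Prod.fst h) (k, i)

theorem HasExactScheme.add (h₁ : HasExactScheme K N F₁ c₁ s₁) (h₂ : HasExactScheme K N F₂ c₂ s₂) :
    HasExactScheme K N (F₁ + F₂) (c₁ + c₂) (s₁ + s₂) := by
  obtain ⟨S₁, rfl, rfl, h₁⟩ := h₁
  obtain ⟨S₂, rfl, rfl, h₂⟩ := h₂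
  let left (W : Fin N → Fin F₁ ⊕ Fin F₂ → Bool) : Library N F₁ := fun n => W n ∘ Sum.inl
  let right (W : Fin N → Fin F₁ ⊕ Fin F₂ → Bool) : Library N F₂ := fun n => W n ∘ Sum.inr
  refine .of_factorsThrough (β := Fin F₁ ⊕ Fin F₂) (σ := Fin S₁.sentBits ⊕ Fin S₂.sentBits)
    (κ := fun _ => Fin S₁.cacheBits ⊕ Fin S₂.cacheBits) (by simp) (by simp) (by simp)
    (fun k W => Sum.elim (S₁.cache k (left W)) (S₂.cache k (right W)))
    (fun d W => Sum.elim (S₁.send d (left W)) (S₂.send d (right W))) fun d k W V h => ?_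
  simp only [Prod.mk.injEq, Sum.elim_eq_iff] at h
  obtain ⟨⟨hsend₁, hsend₂⟩, hcache₁, hcache₂⟩ := h
  have hleft : left W (d k) = left V (d k) := by
    rw [← h₁ d k (left W), ← h₁ d k (left V), Scheme.output, Scheme.output, hsend₁, hcache₁]
  have hright : right W (d k) = right V (d k) := by
    rw [← h₂ d k (right W), ← h₂ d k (right V), Scheme.output, Scheme.output, hsend₂, hcache₂]
  funext i
  obtain i | i := i
  · exact congrFun hleft i
  · exact congrFun hright i

theorem HasExactScheme.mul (h : HasExactScheme K N F c s) (m : ℕ) :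
    HasExactScheme K N (m * F) (m * c) (m * s) := by
  induction m with
  | zero => simpa using hasExactScheme_uncoded K N 0
  | succ m ih => simpa only [Nat.succ_mul] using ih.add h

theorem HasExactScheme.pad (h : HasExactScheme K N F c s) (r : ℕ) :
    HasExactScheme K N (F + r) c (s + K * r) :=
  h.add (hasExactScheme_uncoded K N r)

theorem card_mul_card_filter_mem_powersetCard {α : Type*} [Fintype α] [DecidableEq α] (t : ℕ)
    (k : α) : Fintype.card α * #{A ∈ powersetCard t (univ : Finset α) | k ∈ A} =
      t * (Fintype.card α).choose t := by
  obtain _ | t := t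
  · simp
  have hcard : #{A ∈ powersetCard (t + 1) (univ : Finset α) | k ∈ A} =
      (Fintype.card α - 1).choose t := by
    simpa using card_filter_powersetCard_subset {k} (univ : Finset α) (t + 1) (subset_univ _)
      (by simp)
  have hpos : 0 < Fintype.card α := Fintype.card_pos_iff.mpr ⟨k⟩
  have hchoose := Nat.add_one_mul_choose_eq (Fintype.card α - 1) t
  rw [Nat.sub_add_cancel hpos] at hchoose
  rw [hcard, hchoose, mul_comm]

/-- The pieces of a file are indexed by the sets `A` of `t` users and cached by the users in `A`.
For each set of `t + 1` users the sum is sent of the pieces which all of them but one have cached,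
and which this one has requested. -/
theorem hasExactScheme_multicast (hK : 0 < K) (hc : K * c = t * K.choose t) :
    HasExactScheme K N (K.choose t) (N * c) (K.choose (t + 1)) := by
  have hcached (k : Fin K) : Fintype.card {A : Finset (Fin K) // #A = t ∧ k ∈ A} = c := by
    have hcount := card_mul_card_filter_mem_powersetCard t k
    rw [Fintype.card_fin, ← hc] at hcount
    rw [← Nat.eq_of_mul_eq_mul_left hK hcount]
    exact Fintype.card_of_subtype _ fun A => by simp [mem_powersetCard]
  let piece (S : {S : Finset (Fin K) // #S = t + 1}) (j : S.1) : {A : Finset (Fin K) // #A = t} :=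
    ⟨S.1.erase j, by rw [card_erase_of_mem j.2, S.2, Nat.add_sub_cancel]⟩
  refine .of_factorsThrough (β := {A : Finset (Fin K) // #A = t})
    (σ := {S : Finset (Fin K) // #S = t + 1})
    (κ := fun k => Fin N × {A : Finset (Fin K) // #A = t ∧ k ∈ A})
    (by simp) (fun k => by rw [Fintype.card_prod, Fintype.card_fin, hcached]) (by simp)
    (fun k W p => W p.1 ⟨p.2.1, p.2.2.1⟩) (fun d W S => ∑ j : S.1, W (d j) (piece S j))
    fun d k W V h => funext fun A => ?_
  obtain ⟨hsend, hcache⟩ := Prod.mk.inj h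
  have hknown (n : Fin N) (B : {A : Finset (Fin K) // #A = t}) (hB : k ∈ B.1) : W n B = V n B :=
    congrFun hcache (n, ⟨B.1, B.2, hB⟩)
  by_cases hkA : k ∈ A.1
  · exact hknown _ A hkA
  let S : {S : Finset (Fin K) // #S = t + 1} :=
    ⟨insert k A.1, by rw [card_insert_of_notMem hkA, A.2]⟩
  let k' : S.1 := ⟨k, mem_insert_self k A.1⟩
  have hpiece : piece S k' = A := Subtype.ext (erase_insert hkA)
  have hother : ∑ j ∈ {k'}ᶜ, W (d j) (piece S j) = ∑ j ∈ {k'}ᶜ, V (d j) (piece S j) := by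
    refine sum_congr rfl fun j hj => hknown _ _ (mem_erase.mpr ⟨fun hkj => ?_, k'.2⟩)
    exact (by simpa using hj : j ≠ k') (Subtype.ext hkj.symm)
  have hsum : ∑ j : S.1, W (d j) (piece S j) = ∑ j : S.1, V (d j) (piece S j) := congrFun hsend S
  rw [Fintype.sum_eq_add_sum_compl k', Fintype.sum_eq_add_sum_compl k', hother, hpiece] at hsum
  exact add_right_cancel hsum

theorem HasExactScheme.zeroErrorAchievable (h : HasExactScheme K N F c s) (hF : 0 < F) :
    ZeroErrorAchievable K N (c / F) (s / F) := by
  intro ε hε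
  filter_upwards [Filter.eventually_gt_atTop 0,
    tendsto_natCast_atTop_atTop.eventually_ge_atTop (K * F / ε)] with n hn hεn
  rw [div_le_iff₀ hε] at hεn
  have hn' : (0 : ℝ) < n := by exact_mod_cast hn
  have hcopies : ((n / F : ℕ) : ℝ) ≤ n / F := Nat.cast_div_le
  have hrest : ((n % F : ℕ) : ℝ) ≤ F := by exact_mod_cast (Nat.mod_lt n hF).le
  have hS := (h.mul (n / F)).pad (n % F)
  rw [Nat.div_add_mod'] at hS
  obtain ⟨S, hcache, hsent, hout⟩ := hS
  refine ⟨S, ?_, ?_, hout⟩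
  · rw [Scheme.FitsCache, hcache]
    push_cast
    calc ((n / F : ℕ) : ℝ) * c ≤ n / F * c := by gcongr
      _ = c / F * n := by ring
  · rw [Scheme.delay, hsent, div_le_iff₀ hn']
    push_cast
    calc ((n / F : ℕ) : ℝ) * s + K * (n % F : ℕ) ≤ n / F * s + K * F := by gcongr
      _ ≤ n / F * s + n * ε := by gcongr
      _ = (s / F + ε) * n := by ring

theorem ZeroErrorAchievable.achievable {M T : ℝ} (h : ZeroErrorAchievable K N M T) :
    Achievable K N M T := by
  intro ε hε
  filter_upwards [h ε hε] with F ⟨S, hcache, hdelay, hout⟩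
  exact ⟨S, hcache, hdelay, fun d k => by simp [Scheme.errorProb, hout, hε.le]⟩

theorem ZeroErrorAchievable.eventually_hasExactScheme_floor {M T : ℝ}
    (h : ZeroErrorAchievable K N M T) {a : ℝ} (ha : 0 ≤ a) {ε : ℝ} (hε : 0 < ε) :
    ∀ᶠ F : ℕ in Filter.atTop, ∃ c s : ℕ, HasExactScheme K N ⌊a * F⌋₊ c s ∧
      c ≤ a * M * F ∧ s ≤ (a * T + ε) * F := by
  obtain rfl | ha := ha.eq_or_lt
  · refine .of_forall fun F => ⟨0, 0, ?_, by simp, ?_⟩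
    · simpa using hasExactScheme_uncoded K N 0
    · simpa using mul_nonneg hε.le F.cast_nonneg
  have hfloor : Filter.Tendsto (fun F : ℕ => ⌊a * F⌋₊) Filter.atTop Filter.atTop :=
    tendsto_nat_floor_atTop.comp (tendsto_natCast_atTop_atTop.const_mul_atTop ha)
  filter_upwards [hfloor.eventually (h (ε / a) (div_pos hε ha)),
    hfloor.eventually_gt_atTop 0] with F ⟨S, hcache, hdelay, hout⟩ hF
  replace hF : (0 : ℝ) < ⌊a * F⌋₊ := by exact_mod_cast hF
  have hle : (⌊a * F⌋₊ : ℝ) ≤ a * F := Nat.floor_le (by positivity)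
  rw [Scheme.FitsCache] at hcache
  rw [Scheme.delay, div_le_iff₀ hF] at hdelay
  have hM : 0 ≤ M := nonneg_of_mul_nonneg_left (S.cacheBits.cast_nonneg.trans hcache) hF
  have hT : 0 ≤ T + ε / a := nonneg_of_mul_nonneg_left (S.sentBits.cast_nonneg.trans hdelay) hF
  refine ⟨S.cacheBits, S.sentBits, ⟨S, rfl, rfl, hout⟩, ?_, ?_⟩
  · calc (S.cacheBits : ℝ) ≤ M * ⌊a * F⌋₊ := hcache
      _ ≤ M * (a * F) := by gcongr
      _ = a * M * F := by ring
  · calc (S.sentBits : ℝ) ≤ (T + ε / a) * ⌊a * F⌋₊ := hdelay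
      _ ≤ (T + ε / a) * (a * F) := by gcongr
      _ = (a * T + ε) * F := by
        field_simp

theorem ZeroErrorAchievable.memorySharing {M₁ M₂ T₁ T₂ : ℝ}
    (h₁ : ZeroErrorAchievable K N M₁ T₁) (h₂ : ZeroErrorAchievable K N M₂ T₂) {a b : ℝ}
    (ha : 0 ≤ a) (hb : 0 ≤ b) (hab : a + b = 1) :
    ZeroErrorAchievable K N (a * M₁ + b * M₂) (a * T₁ + b * T₂) := by
  intro ε hε
  filter_upwards [h₁.eventually_hasExactScheme_floor ha (ε := ε / 3) (by positivity),
    h₂.eventually_hasExactScheme_floor hb (ε := ε / 3) (by positivity),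
    Filter.eventually_gt_atTop 0,
    tendsto_natCast_atTop_atTop.eventually_ge_atTop (2 * K / (ε / 3))] with
    F ⟨c₁, s₁, hS₁, hc₁, hs₁⟩ ⟨c₂, s₂, hS₂, hc₂, hs₂⟩ hF hεF
  replace hF : (0 : ℝ) < F := by exact_mod_cast hF
  rw [div_le_iff₀ (by positivity)] at hεF
  have hsplit : a * F + b * F = F := by rw [← add_mul, hab, one_mul]
  have hle : ⌊a * F⌋₊ + ⌊b * F⌋₊ ≤ F := by
    have ha' := Nat.floor_le (mul_nonneg ha hF.le)
    have hb' := Nat.floor_le (mul_nonneg hb hF.le)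
    exact_mod_cast (add_le_add ha' hb').trans_eq hsplit
  obtain ⟨r, hr⟩ := Nat.exists_eq_add_of_le hle
  have hr2 : (r : ℝ) ≤ 2 := by
    have hrF : (F : ℝ) = ⌊a * F⌋₊ + ⌊b * F⌋₊ + r := by exact_mod_cast hr
    linarith [Nat.lt_floor_add_one (a * F), Nat.lt_floor_add_one (b * F)]
  have hS := (hS₁.add hS₂).pad r
  rw [← hr] at hS
  obtain ⟨S, hcache, hsent, hout⟩ := hS
  refine ⟨S, ?_, ?_, hout⟩
  · rw [Scheme.FitsCache, hcache]
    push_cast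
    linarith
  · rw [Scheme.delay, hsent, div_le_iff₀ hF]
    push_cast
    have hrest : K * (r : ℝ) ≤ K * 2 := by gcongr
    linarith

theorem zeroErrorAchievable_multicast (N : ℕ) (hK : 0 < K) (ht : t ≤ K) :
    ZeroErrorAchievable K N (N * (t / K)) ((K - t) / (t + 1)) := by
  obtain ⟨c, hc⟩ : ∃ c, K * c = t * K.choose t :=
    ⟨_, by simpa using card_mul_card_filter_mem_powersetCard t (⟨0, hK⟩ : Fin K)⟩
  have hF : 0 < K.choose t := Nat.choose_pos ht
  have hKR : (K : ℝ) ≠ 0 := by exact_mod_cast hK.ne'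
  have hFR : (K.choose t : ℝ) ≠ 0 := by exact_mod_cast hF.ne'
  have hmem : ((N * c : ℕ) : ℝ) / K.choose t = N * (t / K) := by
    have hcR : (K : ℝ) * c = t * K.choose t := by exact_mod_cast hc
    push_cast
    field_simp
    linear_combination (N : ℝ) * hcR
  have hdelay : (K.choose (t + 1) : ℝ) / K.choose t = (K - t) / (t + 1) := by
    have hchoose : (K.choose (t + 1) * (t + 1) : ℝ) = K.choose t * (K - t) := by
      rw [← Nat.cast_sub ht]
      exact_mod_cast Nat.choose_succ_right_eq K t
    rw [div_eq_div_iff hFR (by positivity), hchoose, mul_comm]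
  rw [← hmem, ← hdelay]
  exact (hasExactScheme_multicast hK hc).zeroErrorAchievable hF

theorem zeroErrorAchievable_sharedDelay (N : ℕ) {γ : ℝ} (ht : t < K) (hlo : t ≤ K * γ)
    (hhi : K * γ ≤ t + 1) : ZeroErrorAchievable K N (N * γ) (sharedDelay K t γ) := by
  have hK : 0 < K := by omega
  have hKR : (K : ℝ) ≠ 0 := by exact_mod_cast hK.ne'
  have hshare := (zeroErrorAchievable_multicast N hK ht.le).memorySharing
    (zeroErrorAchievable_multicast N hK ht)
    (sub_nonneg.mpr hhi) (sub_nonneg.mpr hlo) (by ring)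
  convert hshare using 1
  · push_cast
    field_simp
    ring
  · rw [sharedDelay]
    push_cast
    ring

end Schemes

section Comparison

variable {K N t : ℕ} {γ : ℝ}

/-- The lower bound on the delay that `k` users obtain by decoding `s` files in turn, in terms of
the number `x` of copies of the library which all caches together can hold. -/
noncomputable def converseBound (k s x : ℝ) : ℝ := s - x * (s * (s + 1) / (2 * (k + 1 - s)))

theorem sum_range_one_sub_mul (s : ℕ) (y : ℝ) :
    ∑ i ∈ range s, (1 - (i + 1) * y) = s - y * (s * (s + 1) / 2) := by
  induction s with
  | zero => simp
  | succ s ih =>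
    rw [sum_range_succ, ih]
    push_cast
    ring

theorem Achievable.converseBound_le {T : ℝ} (h : Achievable K N (N * γ) T) (hKN : K ≤ N)
    (hγ : 0 ≤ γ) {s : ℕ} (hsK : s ≤ K) : converseBound K s (K * γ) ≤ T := by
  have hs : (0 : ℝ) < K + 1 - s := by
    have : (s : ℝ) ≤ K := by exact_mod_cast hsK
    linarith
  have hterm : ∀ i ∈ range s, 1 - (i + 1) * (K * γ / (K + 1 - s)) ≤
      1 - (i + 1) * (N * γ) / (N - i : ℝ) := by
    intro i hi
    have his : (i : ℝ) + 1 ≤ s := by exact_mod_cast mem_range.mp hi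
    have hsN : (s : ℝ) ≤ N := by exact_mod_cast hsK.trans hKN
    have hKi : (K : ℝ) * i ≤ N * i := by gcongr
    have hNi : (N : ℝ) * (i + 1) ≤ N * s := by gcongr
    rw [mul_div_assoc ((i : ℝ) + 1) (N * γ)]
    gcongr 1 - (i + 1) * ?_
    rw [div_le_div_iff₀ (by linarith) hs]
    have hcross : (N : ℝ) * (K + 1 - s) ≤ K * (N - i) := by linarith
    linarith [mul_le_mul_of_nonneg_right hcross hγ]
  calc converseBound K s (K * γ)
      = s - K * γ / (K + 1 - s) * (s * (s + 1) / 2) := by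
        rw [converseBound, mul_comm (2 : ℝ), ← div_div]
        ring
    _ = ∑ i ∈ range s, (1 - (i + 1) * (K * γ / (K + 1 - s))) := (sum_range_one_sub_mul s _).symm
    _ ≤ ∑ i ∈ range s, (1 - (i + 1) * (N * γ) / (N - i : ℝ)) := sum_le_sum hterm
    _ ≤ T := h.lower_bound hsK (hsK.trans hKN)

theorem sharedDelay_eq (K t : ℕ) (γ : ℝ) :
    sharedDelay K t γ = ((K : ℝ) - t) / (t + 1) -
      (K * γ - t) * (K + 1) / ((t + 1) * (t + 2)) := by
  unfold sharedDelay
  field_simp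
  ring

theorem sharedDelay_le (ht : t < K) (hlo : t ≤ K * γ) :
    sharedDelay K t γ ≤ (K - K * γ) / (t + 1) := by
  have htK : (t : ℝ) + 1 ≤ K := by exact_mod_cast ht
  have hslope : (K * γ - t) * (t + 2) ≤ (K * γ - t) * (K + 1) :=
    mul_le_mul_of_nonneg_left (by linarith) (sub_nonneg.mpr hlo)
  calc sharedDelay K t γ
      = ((K : ℝ) - t) / (t + 1) - (K * γ - t) * (K + 1) / ((t + 1) * (t + 2)) :=
        sharedDelay_eq K t γ
    _ ≤ ((K : ℝ) - t) / (t + 1) - (K * γ - t) * (t + 2) / ((t + 1) * (t + 2)) := by gcongr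
    _ = (K - K * γ) / (t + 1) := by
        field_simp
        ring

theorem delay_lt_converseBound_left {k s τ : ℝ} (hτ : 0 ≤ τ) (hs : 2 ≤ s)
    (hlow : 2 * (τ + 1) * s ≤ k) (hup : k + 1 ≤ 2 * (τ + 1) * (s + 1)) :
    (k - τ) / (τ + 1) < 4 * converseBound k s τ := by
  have hτs : 0 ≤ τ * s := by positivity
  have hk : 0 < 2 * (k + 1 - s) := by linarith
  have hdelay : (k - τ) / (τ + 1) ≤ 2 * s + 1 := by
    rw [div_le_iff₀ (by positivity)]
    linarith
  have hloss : 4 * (τ * (s * (s + 1) / (2 * (k + 1 - s)))) < s + 1 := by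
    rw [← mul_div_assoc, ← mul_div_assoc, div_lt_iff₀ hk]
    have hmul : (s + 1) * (2 * τ * s) < (s + 1) * (k + 1 - s) := by
      gcongr
      linarith
    linarith
  rw [converseBound]
  linarith

theorem delay_lt_converseBound_right {k s τ : ℝ} (hτ : 0 ≤ τ) (hs : 2 ≤ s)
    (hlow : 2 * (τ + 1) * s ≤ k) (hup : k + 1 ≤ 2 * (τ + 1) * (s + 1)) :
    (k - (τ + 1)) / (τ + 2) < 4 * converseBound k s (τ + 1) := by
  set D : ℝ := (2 * τ + 1) * s + 1 with hD
  have hDpos : 0 < D := by positivity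
  have hDk : D ≤ k + 1 - s := by linarith
  have hloss : 4 * ((τ + 1) * (s * (s + 1) / (2 * (k + 1 - s)))) ≤
      2 * (τ + 1) * s * (s + 1) / D :=
    calc 4 * ((τ + 1) * (s * (s + 1) / (2 * (k + 1 - s))))
        ≤ 4 * ((τ + 1) * (s * (s + 1) / (2 * D))) := by gcongr
      _ = 2 * (τ + 1) * s * (s + 1) / D := by
          field_simp
          ring
  have hpoly : 0 < D * (2 * τ * s + 6 * s - τ) - 2 * (τ + 1) * (τ + 2) * s * (s + 1) := by
    obtain ⟨u, hu, rfl⟩ : ∃ u, 0 ≤ u ∧ s = 2 + u := ⟨s - 2, by linarith, by ring⟩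
    calc (0 : ℝ) < 21 * τ + 12 + (4 * τ ^ 2 + 27 * τ + 10) * u +
          (2 * τ ^ 2 + 8 * τ + 2) * u ^ 2 := by positivity
      _ = _ := by
          rw [hD]
          ring
  calc (k - (τ + 1)) / (τ + 2)
      ≤ (2 * (τ + 1) * s + τ) / (τ + 2) := by
        gcongr
        linarith
    _ < 4 * s - 2 * (τ + 1) * s * (s + 1) / D := by
        rw [div_lt_iff₀ (by positivity), sub_mul, div_mul_eq_mul_div, lt_sub_comm,
          div_lt_iff₀ hDpos]
        linarith
    _ ≤ 4 * converseBound k s (τ + 1) := by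
        rw [converseBound]
        linarith

/-- Both sides are affine in `K * γ`, which reduces the comparison to `K * γ = t` and
`K * γ = t + 1`. -/
theorem sharedDelay_lt_converseBound {s : ℝ} (hlo : t ≤ K * γ) (hhi : K * γ ≤ t + 1) (hs : 2 ≤ s)
    (hlow : 2 * (t + 1) * s ≤ K) (hup : K + 1 ≤ 2 * (t + 1) * (s + 1)) :
    sharedDelay K t γ < 4 * converseBound K s (K * γ) := by
  have hleft := sub_pos.mpr (delay_lt_converseBound_left t.cast_nonneg hs hlow hup)
  have hright := sub_pos.mpr (delay_lt_converseBound_right t.cast_nonneg hs hlow hup)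
  have hpos := convex_Ioi (0 : ℝ) hleft hright (sub_nonneg.mpr hhi) (sub_nonneg.mpr hlo) (by ring)
  simp only [converseBound, smul_eq_mul, Set.mem_Ioi] at hpos
  rw [sharedDelay, converseBound]
  linarith

theorem exists_sharedDelay_lt_converseBound (ht : t < K) (hlo : t ≤ K * γ) (hhi : K * γ ≤ t + 1)
    (hγ : γ < 1) : ∃ s ≤ K, sharedDelay K t γ < 4 * converseBound K s (K * γ) := by
  have hK : (0 : ℝ) < K := by exact_mod_cast t.zero_le.trans_lt ht
  obtain hfew | hmany := lt_or_ge K (4 * (t + 1))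
  · refine ⟨1, by omega, ?_⟩
    have hfew' : (K : ℝ) < 4 * (t + 1) := by exact_mod_cast hfew
    calc sharedDelay K t γ
        ≤ (K - K * γ) / (t + 1) := sharedDelay_le ht hlo
      _ = K * (1 - γ) / (t + 1) := by ring
      _ < 4 * (t + 1) * (1 - γ) / (t + 1) := by
          gcongr
      _ = 4 * converseBound K (1 : ℕ) (K * γ) := by
          rw [converseBound, Nat.cast_one, add_sub_cancel_right]
          field_simp
          ring
  · refine ⟨K / (2 * (t + 1)), Nat.div_le_self _ _, ?_⟩
    have hpos : 0 < 2 * (t + 1) := by positivity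
    refine sharedDelay_lt_converseBound hlo hhi ?_ ?_ ?_
    · exact_mod_cast (Nat.le_div_iff_mul_le hpos).mpr (by omega)
    · exact_mod_cast Nat.mul_div_le K (2 * (t + 1))
    · exact_mod_cast Nat.lt_mul_div_succ K hpos

theorem sharedDelay_lt_four_mul_optimalDelay (hKN : K ≤ N) (ht : t < K) (hlo : t ≤ K * γ)
    (hhi : K * γ ≤ t + 1) (hγ : γ < 1) :
    sharedDelay K t γ < 4 * optimalDelay K N (N * γ) := by
  have hK : (0 : ℝ) < K := by exact_mod_cast t.zero_le.trans_lt ht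
  have hγ0 : 0 ≤ γ := nonneg_of_mul_nonneg_right (t.cast_nonneg.trans hlo) hK
  obtain ⟨s, hsK, hs⟩ := exists_sharedDelay_lt_converseBound ht hlo hhi hγ
  have hopt : converseBound K s (K * γ) ≤ optimalDelay K N (N * γ) :=
    le_csInf ⟨_, (zeroErrorAchievable_sharedDelay N ht hlo hhi).achievable⟩
      fun _ hT => hT.converseBound_le hKN hγ0 hsK
  linarith

end Comparison

end CodedCaching

theorem proposition1 (K N t : ℕ) (M γ : ℝ) (hNK : K ≤ N) (ht : t < K) (hγ : γ = M / (N : ℝ))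
    (hlo : (t : ℝ) ≤ (K : ℝ) * γ) (hhi : (K : ℝ) * γ ≤ (t : ℝ) + 1) :
    CodedCaching.sharedDelay K t γ =
        ((K : ℝ) - (t : ℝ)) / ((t : ℝ) + 1) -
          ((K : ℝ) * γ - (t : ℝ)) * ((K : ℝ) + 1) / (((t : ℝ) + 1) * ((t : ℝ) + 2)) ∧
      CodedCaching.ZeroErrorAchievable K N M (CodedCaching.sharedDelay K t γ) ∧
      CodedCaching.Achievable K N M (CodedCaching.sharedDelay K t γ) ∧
      CodedCaching.sharedDelay K t γ ≤ 4 * CodedCaching.optimalDelay K N M ∧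
      (γ < 1 → 0 < CodedCaching.optimalDelay K N M ∧
        CodedCaching.sharedDelay K t γ / CodedCaching.optimalDelay K N M < 4) := by
  obtain rfl : M = N * γ := by
    have hN : (N : ℝ) ≠ 0 := by exact_mod_cast (t.zero_le.trans_lt (ht.trans_le hNK)).ne'
    rw [hγ, mul_div_cancel₀ M hN]
  have hzero := CodedCaching.zeroErrorAchievable_sharedDelay N ht hlo hhi
  have hlt := CodedCaching.sharedDelay_lt_four_mul_optimalDelay hNK ht hlo hhi
  have hopt : 0 ≤ CodedCaching.optimalDelay K N (N * γ) :=
    Real.sInf_nonneg fun T hT => hT.nonneg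
  refine ⟨CodedCaching.sharedDelay_eq K t γ, hzero, hzero.achievable, ?_, fun hγ1 => ?_⟩
  · obtain hγ1 | hγ1 := lt_or_ge γ 1
    · exact (hlt hγ1).le
    · have hfull : (K : ℝ) ≤ K * γ := le_mul_of_one_le_right K.cast_nonneg hγ1
      have hnonpos := (CodedCaching.sharedDelay_le ht hlo).trans
        (div_nonpos_of_nonpos_of_nonneg (sub_nonpos.mpr hfull) (by positivity))
      linarith
  · have hpos : 0 < CodedCaching.optimalDelay K N (N * γ) := by
      linarith [hlt hγ1, hzero.achievable.nonneg]
    exact ⟨hpos, (div_lt_iff₀ hpos).mpr (hlt hγ1)⟩
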